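/- **Theorem (convergence rate of AGS-Adam).** For $g:\mathbb R^d\to\mathbb R$ and a symmetric matrix $\Sigma\in\mathbb R^{d\times d}$ let $$g_\Sigma(x)=\pi^{-d/2}\int_{\mathbb R^d} g(x+\Sigma u)\,e^{-\|u\|^2}\,du ,$$ so that $g_0=g$. Let $f_1,\dots,f_K:\mathbb R^d\to\mathbb R$ be differentiable and let $f$ satisfy $f(x)=\mathbb E[f_k(x)]=\frac1K\sum_{j=1}^K f_j(x)$ and $\nabla f(x)=\mathbb E[\nabla f_k(x)]=\frac1K\sum_{j=1}^K\nabla f_j(x)$ for all $x$, where $k$ is uniform on $\{1,\dots,K\}$. Assume that $f$ is $L$-smooth (differentiable with $L$-Lipschitz gradient) with minimum $f^*$, and that $\mathbb E\|\nabla f_k(x)\|^2=\frac1K\sum_{j}\|\nabla f_j(x)\|^2\le\lambda$ for all $x$. Let $\Sigma_1,\Sigma_2,\dots$ be symmetric positive definite matrices, let $\Sigma_0=0$, and let $\epsilon>0$, $0\le\beta_t\le\beta<1$, $\theta_t\in(0,1)$, $\eta_t>0$ for $t\ge1$. Starting from $x_0\in\mathbb R^d$, $m_0=v_0=0$, AGS-Adam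 draws independent indices $k_t$, $t\geq 1$, uniform on $\{1,\dots,K\}$, and sets $$m_t=\beta_t m_{t-1}+(1-\beta_t)g_t,\qquad v_t=\theta_t v_{t-1}+(1-\theta_t)g_t^2,\qquad x_t=x_{t-1}-\eta_t\frac{m_t}{\sqrt{v_t+\epsilon}},\qquad g_t=\nabla f_{k_t,\Sigma_t}(x_{t-1}),$$ where $f_{k,\Sigma}=(f_k)_\Sigma$ and squares, roots and quotients of vectors are coordinatewise. Let $M$ satisfy $\|\nabla f_{j,\Sigma_t}(x)\|\le M$ for all $j\in\{1,\dots,K\}$, $t\ge1$, $x\in\mathbb R^d$ (any uniform bound on the $\|\nabla f_j(x)\|$ will do, for instance $M=\sqrt{K\lambda}$). Let $B,\widetilde B$ be real functions of two matrices such that for all $t\ge1$ and all $x$ $$|f_{\Sigma_t}(x)-f_{\Sigma_{t-1}}(x)|\le B(\Sigma_t,\Sigma_{t-1}),\qquad \|\nabla f_{\Sigma_{t+1}}(x)-\nabla f_{\Sigma_t}(x)\|\le\widetilde B(\Sigma_{t+1},\Sigma_t).$$ Suppose that $\widetilde B(\Sigma_{t+1},\Sigma_t)\le\widetilde M\eta_t$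 for all $t\ge1$ and some $\widetilde M>0$, that $\sum_{t\ge1}B(\Sigma_t,\Sigma_{t-1})<\infty$, and that there are a non-increasing real sequence $(\alpha_t)_{t\ge1}$ and constants $C_0,\widetilde C_0>0$ with $C_0\alpha_t\le\eta_t\le\widetilde C_0\alpha_t$ for all $t\ge1$. Then for every $T\ge1$ the functions $f_{\Sigma_t}$ and $f_{j,\Sigma_t}$ ($1\le t\le T$, $1\le j\le K$) are differentiable, the expectations below are finite, and $$\min_{1\le t\le T}\mathbb E\big[\|\nabla f_{\Sigma_t}(x_{t-1})\|^2\big]\le\frac{C_1+C_2\sum_{t=1}^T\eta_t(1-\theta_t)+C_3\sum_{t=1}^T\eta_t^2}{\sum_{t=1}^T\eta_t},$$ where $$C_1=\frac{\sqrt{M^2+\epsilon}}{1-\beta}\Big(f(x_0)-f^*+\sum_{t=1}^TB(\Sigma_t,\Sigma_{t-1})\Big),\qquad C_2=\frac{\sqrt d\,M^4\,\widetilde C_0\sqrt{M^2+\epsilon}}{\epsilon^{3/2}C_0(1-\beta)^2},$$ $$C_3=\frac{\sqrt{M^2+\epsilon}}{(1-\beta)^2}\Big(\frac{2M^2L}{\epsilon}+\frac{\beta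 M\widetilde M}{\sqrt\epsilon}\Big).$$ -/

import Mathlib

open MeasureTheory ProbabilityTheory
open scoped NNReal

namespace AGS

/-- The `S`-Gaussian smoothing
`g_S(x) = π^(-d/2) ∫ g(x + S u) exp(-‖u‖²) du` of a function `g` on `ℝᵈ`.
For `S = 0` this is `g` itself. -/
noncomputable def smooth {d : ℕ} (S : Matrix (Fin d) (Fin d) ℝ)
    (g : EuclideanSpace ℝ (Fin d) → ℝ) (x : EuclideanSpace ℝ (Fin d)) : ℝ :=
  (1 / Real.pi ^ ((d : ℝ) / 2)) *
    ∫ u : EuclideanSpace ℝ (Fin d), g (x + Matrix.toEuclideanCLM (𝕜 := ℝ) S u) *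
      Real.exp (-‖u‖ ^ 2)

/-- `f` is `L`-smooth: it is differentiable and its gradient is `L`-Lipschitz. -/
def LSmooth {d : ℕ} (L : ℝ≥0) (f : EuclideanSpace ℝ (Fin d) → ℝ) : Prop :=
  Differentiable ℝ f ∧ LipschitzWith L (gradient f)

/-- The iterate `x`, the first moment `m` and the second moment `v` of the algorithm. -/
structure AdamState (d : ℕ) where
  x : EuclideanSpace ℝ (Fin d)
  m : EuclideanSpace ℝ (Fin d)
  v : EuclideanSpace ℝ (Fin d)

/-- One step of the algorithm from the state `s`, with stochastic gradient `g` and with parameters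
`η`, `β`, `θ`, `ε`; squares, square roots and quotients of vectors are taken coordinatewise. -/
noncomputable def adamStep {d : ℕ} (ε η β θ : ℝ) (g : EuclideanSpace ℝ (Fin d))
    (s : AdamState d) : AdamState d :=
  let m : EuclideanSpace ℝ (Fin d) := β • s.m + (1 - β) • g
  let v : EuclideanSpace ℝ (Fin d) :=
    WithLp.toLp 2 fun i => θ * s.v i + (1 - θ) * (g i) ^ 2
  { x := s.x - η • WithLp.toLp 2 fun i => m i / Real.sqrt (v i + ε)
    m := m
    v := v }

/-- AGS-Adam, run on the functions `F j` with smoothing matrices `S t`, step sizes `η t`, momentum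
parameters `β t` and `θ t` (`t ≥ 1`), started at `x₀`, when `κ t` is the index drawn at step `t`.
The value at `t` is the state `(x_t, m_t, v_t)` after `t` steps. -/
noncomputable def adam {d K : ℕ} (F : Fin K → EuclideanSpace ℝ (Fin d) → ℝ)
    (S : ℕ → Matrix (Fin d) (Fin d) ℝ) (ε : ℝ) (η β θ : ℕ → ℝ)
    (x₀ : EuclideanSpace ℝ (Fin d)) (κ : ℕ → Fin K) : ℕ → AdamState d
  | 0 => { x := x₀, m := 0, v := 0 }
  | t + 1 =>
    let s := adam F S ε η β θ x₀ κ t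
    adamStep ε (η (t + 1)) (β (t + 1)) (θ (t + 1))
      (gradient (smooth (S (t + 1)) (F (κ (t + 1)))) s.x) s

end AGS

/-! Write p_t for the expectation of P_t, the inner product of ∇f_{Σ_t}(x_{t-1}) with the step
direction m_t/√(v_t+ε). The rate comes from bounding Σ η_t p_t from both sides.

Upper bound. Gaussian smoothing averages translates of f, so it keeps L-smoothness and the lower
bound f*. The descent inequality for f_{Σ_t} (`LSmooth.le_of_step`) loses a multiple of η_t²,
passing from f_{Σ_{t-1}} to f_{Σ_t} costs B, and the sum telescopes from f(x₀).

Lower bound. Replacing v_{t+1} by v_t in the direction costs O(1-θ_{t+1})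
(`inner_precond_adamStep_ge`). As v_t does not involve the next index, the fresh gradient
contributes, on average, at least ‖∇f_{Σ_{t+1}}(x_t)‖²/√(M²+ε) (`integral_history_next`,
`norm_sq_div_le_inner_precond`). The old momentum contributes P_t up to O(η_t), the drift of the
gradient when x and Σ move (`inner_gradient_precond_ge`). Thus p_{t+1} is at least a
squared-gradient term plus β_{t+1} p_t minus errors.

Unrolling leaves errors that are geometric convolutions Σ_{s<t} β^{t-1-s} a_s. Weighted by η and
summed, each costs a factor 1/(1-β). The 1-θ errors need nearly monotone weights, whence the ratio
of the two constants comparing η with α; the η errors are quadratic and need only Young's inequality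
(`sum_mul_le_of_momentum_recursion`). -/

namespace AGS

/-! ### Gaussian smoothing -/

/-- The probability measure on `ℝᵈ` with density `π^(-d/2) exp(-‖u‖²)`. -/
noncomputable def gaussian (d : ℕ) : Measure (EuclideanSpace ℝ (Fin d)) :=
  volume.withDensity fun u =>
    ((1 / Real.pi ^ ((d : ℝ) / 2) * Real.exp (-‖u‖ ^ 2)).toNNReal : ℝ≥0)

theorem measurable_gaussianDensity (d : ℕ) :
    Measurable fun u : EuclideanSpace ℝ (Fin d) =>
      (1 / Real.pi ^ ((d : ℝ) / 2) * Real.exp (-‖u‖ ^ 2)).toNNReal := by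
  fun_prop

theorem integral_gaussian {d : ℕ} (g : EuclideanSpace ℝ (Fin d) → ℝ) :
    ∫ u, g u ∂gaussian d =
      1 / Real.pi ^ ((d : ℝ) / 2) * ∫ u, g u * Real.exp (-‖u‖ ^ 2) := by
  rw [gaussian, integral_withDensity_eq_integral_smul (measurable_gaussianDensity d),
    ← integral_const_mul]
  refine integral_congr_ae (Filter.Eventually.of_forall fun u => ?_)
  simp only [NNReal.smul_def, smul_eq_mul]
  rw [Real.coe_toNNReal _ (by positivity)]
  ring

theorem integrable_gaussian_iff {d : ℕ} (g : EuclideanSpace ℝ (Fin d) → ℝ) :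
    Integrable g (gaussian d) ↔
      Integrable fun u => 1 / Real.pi ^ ((d : ℝ) / 2) * (g u * Real.exp (-‖u‖ ^ 2)) := by
  rw [gaussian, integrable_withDensity_iff_integrable_smul (measurable_gaussianDensity d)]
  refine integrable_congr (Filter.Eventually.of_forall fun u => ?_)
  simp only [NNReal.smul_def, smul_eq_mul]
  rw [Real.coe_toNNReal _ (by positivity)]
  ring

theorem integrable_exp_neg_mul_norm_sq {d : ℕ} {b : ℝ} (hb : 0 < b) :
    Integrable fun u : EuclideanSpace ℝ (Fin d) => Real.exp (-b * ‖u‖ ^ 2) := by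
  have h := GaussianFourier.integrable_cexp_neg_mul_sq_norm_add (V := EuclideanSpace ℝ (Fin d))
    (b := (b : ℂ)) (by simpa using hb) 0 0
  refine h.norm.congr (Filter.Eventually.of_forall fun u => ?_)
  simp [Complex.norm_exp, ← Complex.ofReal_pow]

instance (d : ℕ) : IsProbabilityMeasure (gaussian d) := by
  have hfin : Integrable (fun _ => (1 : ℝ)) (gaussian d) := by
    rw [integrable_gaussian_iff]
    refine ((integrable_exp_neg_mul_norm_sq (d := d) one_pos).const_mul
      (1 / Real.pi ^ ((d : ℝ) / 2))).congr
      (Filter.Eventually.of_forall fun u => ?_)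
    simp
  have : IsFiniteMeasure (gaussian d) := by
    rwa [integrable_const_iff_isFiniteMeasure one_ne_zero] at hfin
  have h1 : ∫ _, (1 : ℝ) ∂gaussian d = 1 := by
    rw [integral_gaussian]
    have h := GaussianFourier.integral_rexp_neg_mul_sq_norm (V := EuclideanSpace ℝ (Fin d)) one_pos
    simp only [neg_mul, one_mul, finrank_euclideanSpace, Fintype.card_fin, div_one] at h ⊢
    rw [h]
    have : Real.pi ^ ((d : ℝ) / 2) ≠ 0 := by positivity
    field_simp
  refine ⟨?_⟩
  simp only [integral_const, smul_eq_mul, mul_one] at h1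
  rw [← ENNReal.toReal_eq_one_iff]
  exact h1

/-- Lipschitz functions grow at most linearly, so a finite first moment makes their smoothings well
defined. -/
theorem integrable_norm_gaussian (d : ℕ) :
    Integrable (fun u : EuclideanSpace ℝ (Fin d) => ‖u‖) (gaussian d) := by
  rw [integrable_gaussian_iff]
  refine Integrable.const_mul ?_ _
  refine (integrable_exp_neg_mul_norm_sq (d := d) (b := 1 / 2) (by norm_num)).mono'
    (by fun_prop) (Filter.Eventually.of_forall fun u => ?_)
  rw [Real.norm_of_nonneg (by positivity)]
  calc ‖u‖ * Real.exp (-‖u‖ ^ 2)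
      ≤ Real.exp (1 / 2 * ‖u‖ ^ 2) * Real.exp (-‖u‖ ^ 2) := by
        gcongr
        -- With r = ‖u‖: r ≤ 1 + r²/2 ≤ exp(r²/2), so half of the Gaussian exponent absorbs the
        -- factor r.
        nlinarith [Real.add_one_le_exp (1 / 2 * ‖u‖ ^ 2), sq_nonneg (‖u‖ - 1)]
    _ = Real.exp (-(1 / 2) * ‖u‖ ^ 2) := by rw [← Real.exp_add]; ring_nf

section Smooth

variable {d : ℕ} {g : EuclideanSpace ℝ (Fin d) → ℝ}

theorem smooth_eq_integral (S : Matrix (Fin d) (Fin d) ℝ) (g : EuclideanSpace ℝ (Fin d) → ℝ)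
    (x : EuclideanSpace ℝ (Fin d)) :
    smooth S g x = ∫ u, g (x + Matrix.toEuclideanCLM (𝕜 := ℝ) S u) ∂gaussian d := by
  rw [integral_gaussian, smooth]

theorem smooth_zero (g : EuclideanSpace ℝ (Fin d) → ℝ) : smooth 0 g = g := by
  ext x
  simp [smooth_eq_integral]

theorem integrable_comp_add_gaussian {G : ℝ≥0} (hg : LipschitzWith G g)
    (S : Matrix (Fin d) (Fin d) ℝ) (x : EuclideanSpace ℝ (Fin d)) :
    Integrable (fun u => g (x + Matrix.toEuclideanCLM (𝕜 := ℝ) S u)) (gaussian d) := by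
  set A := Matrix.toEuclideanCLM (𝕜 := ℝ) S with hA
  refine (((integrable_norm_gaussian d).const_mul (G * ‖A‖)).add
    (integrable_const ‖g x‖)).mono' ?_ (Filter.Eventually.of_forall fun u => ?_)
  · exact (hg.continuous.comp (continuous_const.add A.continuous)).aestronglyMeasurable
  · have h1 := hg.norm_sub_le (x + A u) x
    have h2 : ‖A u‖ ≤ ‖A‖ * ‖u‖ := A.le_opNorm u
    have h3 := norm_le_norm_add_norm_sub' (g (x + A u)) (g x)
    have h4 : (G : ℝ) * ‖A u‖ ≤ G * (‖A‖ * ‖u‖) := by gcongr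
    simp only [add_sub_cancel_left] at h1
    simp only [Pi.add_apply]
    linarith

/-- Differentiation under the integral sign; the Lipschitz constant is a dominating function because
the measure is finite. -/
theorem hasFDerivAt_smooth {G : ℝ≥0} (hd : Differentiable ℝ g) (hg : LipschitzWith G g)
    (S : Matrix (Fin d) (Fin d) ℝ) (x : EuclideanSpace ℝ (Fin d)) :
    Integrable (fun u => fderiv ℝ g (x + Matrix.toEuclideanCLM (𝕜 := ℝ) S u)) (gaussian d) ∧
    HasFDerivAt (smooth S g)
      (∫ u, fderiv ℝ g (x + Matrix.toEuclideanCLM (𝕜 := ℝ) S u) ∂gaussian d) x := by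
  have hs : smooth S g = fun x => ∫ u, g (x + Matrix.toEuclideanCLM (𝕜 := ℝ) S u) ∂gaussian d :=
    funext fun x => smooth_eq_integral S g x
  rw [hs]
  refine hasFDerivAt_integral_of_dominated_loc_of_lip (bound := fun _ => (G : ℝ))
    Filter.univ_mem (Filter.Eventually.of_forall fun y =>
      (integrable_comp_add_gaussian hg S y).aestronglyMeasurable)
    (integrable_comp_add_gaussian hg S x) ?_ (Filter.Eventually.of_forall fun u => ?_)
    (integrable_const _) (Filter.Eventually.of_forall fun u => ?_)
  · exact ((measurable_fderiv ℝ g).comp (by fun_prop)).aestronglyMeasurable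
  · refine LipschitzWith.lipschitzOnWith (LipschitzWith.of_dist_le_mul fun y z => ?_)
    have := hg.dist_le_mul (y + Matrix.toEuclideanCLM (𝕜 := ℝ) S u)
      (z + Matrix.toEuclideanCLM (𝕜 := ℝ) S u)
    simpa using this
  · exact (hasFDerivAt_comp_add_right _).2 (hd _).hasFDerivAt

theorem differentiable_smooth {G : ℝ≥0} (hd : Differentiable ℝ g) (hg : LipschitzWith G g)
    (S : Matrix (Fin d) (Fin d) ℝ) : Differentiable ℝ (smooth S g) :=
  fun x => (hasFDerivAt_smooth hd hg S x).2.differentiableAt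

theorem le_smooth {G : ℝ≥0} (hg : LipschitzWith G g) {c : ℝ} (hc : ∀ x, c ≤ g x)
    (S : Matrix (Fin d) (Fin d) ℝ) (x : EuclideanSpace ℝ (Fin d)) : c ≤ smooth S g x := by
  rw [smooth_eq_integral]
  calc c = ∫ _, c ∂gaussian d := by simp
    _ ≤ _ := integral_mono (integrable_const _) (integrable_comp_add_gaussian hg S x)
      fun u => hc _

theorem norm_gradient_sub_gradient {p q : EuclideanSpace ℝ (Fin d) → ℝ}
    (x y : EuclideanSpace ℝ (Fin d)) :
    ‖gradient p x - gradient q y‖ = ‖fderiv ℝ p x - fderiv ℝ q y‖ := by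
  rw [gradient, gradient, ← map_sub, LinearIsometryEquiv.norm_map]

theorem norm_gradient {p : EuclideanSpace ℝ (Fin d) → ℝ} (x : EuclideanSpace ℝ (Fin d)) :
    ‖gradient p x‖ = ‖fderiv ℝ p x‖ := by
  rw [gradient, LinearIsometryEquiv.norm_map]

theorem inner_gradient {p : EuclideanSpace ℝ (Fin d) → ℝ} (x y : EuclideanSpace ℝ (Fin d)) :
    inner ℝ (gradient p x) y = fderiv ℝ p x y := by
  rw [← toDual_gradient, InnerProductSpace.toDual_apply_apply]

theorem lipschitzWith_of_norm_gradient_le (hd : Differentiable ℝ g) {G : ℝ≥0}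
    (hG : ∀ x, ‖gradient g x‖ ≤ G) : LipschitzWith G g := by
  refine lipschitzWith_of_nnnorm_fderiv_le hd fun x => ?_
  rw [← NNReal.coe_le_coe, coe_nnnorm, ← norm_gradient]
  exact hG x

/-- The derivative of the smoothing is an average of translated derivatives, and averaging preserves
a Lipschitz bound. -/
theorem LSmooth.smooth {G L : ℝ≥0} (hL : LSmooth L g) (hg : LipschitzWith G g)
    (S : Matrix (Fin d) (Fin d) ℝ) : LSmooth L (smooth S g) := by
  refine ⟨differentiable_smooth hL.1 hg S, LipschitzWith.of_dist_le_mul fun x y => ?_⟩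
  obtain ⟨hxi, hx⟩ := hasFDerivAt_smooth hL.1 hg S x
  obtain ⟨hyi, hy⟩ := hasFDerivAt_smooth hL.1 hg S y
  rw [dist_eq_norm, norm_gradient_sub_gradient, hx.fderiv, hy.fderiv, ← integral_sub hxi hyi]
  refine (norm_integral_le_of_norm_le_const (C := L * dist x y)
    (Filter.Eventually.of_forall fun u => ?_)).trans (by simp)
  rw [← norm_gradient_sub_gradient, ← dist_eq_norm]
  simpa using hL.2.dist_le_mul (x + Matrix.toEuclideanCLM (𝕜 := ℝ) S u)
    (y + Matrix.toEuclideanCLM (𝕜 := ℝ) S u)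

/-- The mean value inequality on the segment, relative to the derivative at `x`. It gives `L`
instead of the sharp L/2, which the final constant can afford. -/
theorem LSmooth.le_add {L : ℝ≥0} (hL : LSmooth L g) (x y : EuclideanSpace ℝ (Fin d)) :
    g y ≤ g x + inner ℝ (gradient g x) (y - x) + L * ‖y - x‖ ^ 2 := by
  have h := (convex_segment x y).norm_image_sub_le_of_norm_fderiv_le' (𝕜 := ℝ) (f := g)
    (φ := fderiv ℝ g x) (C := L * ‖y - x‖) (fun z _ => hL.1 z) (fun z hz => ?_)
    (left_mem_segment ℝ x y) (right_mem_segment ℝ x y)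
  · have := (abs_le.1 h).2
    rw [inner_gradient]
    nlinarith
  · rw [← norm_gradient_sub_gradient, ← dist_eq_norm]
    refine (hL.2.dist_le_mul z x).trans ?_
    rw [dist_eq_norm]
    gcongr
    exact norm_sub_le_of_mem_segment hz

theorem smooth_const_mul_sum {K : ℕ} {F : Fin K → EuclideanSpace ℝ (Fin d) → ℝ} {G : ℝ≥0}
    (hF : ∀ j, LipschitzWith G (F j)) {c : ℝ} (hg : ∀ x, c * ∑ j, F j x = g x)
    (S : Matrix (Fin d) (Fin d) ℝ) (x : EuclideanSpace ℝ (Fin d)) :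
    smooth S g x = c * ∑ j, smooth S (F j) x := by
  simp only [smooth_eq_integral, ← hg]
  rw [integral_const_mul, integral_finsetSum _ fun j _ => integrable_comp_add_gaussian (hF j) S x]

theorem gradient_smooth_const_mul_sum {K : ℕ} {F : Fin K → EuclideanSpace ℝ (Fin d) → ℝ}
    {G : ℝ≥0} (hF : ∀ j, LipschitzWith G (F j)) (hd : ∀ j, Differentiable ℝ (F j)) {c : ℝ}
    (hg : ∀ x, c * ∑ j, F j x = g x) (S : Matrix (Fin d) (Fin d) ℝ)
    (x : EuclideanSpace ℝ (Fin d)) :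
    gradient (smooth S g) x = c • ∑ j, gradient (smooth S (F j)) x := by
  have h : smooth S g = fun x => c * ∑ j, smooth S (F j) x :=
    funext fun x => smooth_const_mul_sum hF hg S x
  have hds := fun j => differentiable_smooth (hd j) (hF j) S
  simp only [gradient]
  rw [h, fderiv_const_mul (DifferentiableAt.fun_sum fun j _ => hds j x),
    fderiv_fun_sum fun j _ => hds j x]
  simp

end Smooth

/-! ### Geometric convolutions -/

/-- The sequence with `geomConv b a 0 = 0` and `geomConv b a (t + 1) = a t + b * geomConv b a t`. -/
def geomConv (b : ℝ) (a : ℕ → ℝ) : ℕ → ℝ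
  | 0 => 0
  | t + 1 => a t + b * geomConv b a t

theorem geomConv_nonneg {b : ℝ} (hb : 0 ≤ b) {a : ℕ → ℝ} (ha : ∀ t, 0 ≤ a t) (t : ℕ) :
    0 ≤ geomConv b a t := by
  induction t with
  | zero => exact le_rfl
  | succ t ih => exact add_nonneg (ha t) (mul_nonneg hb ih)

theorem sum_mul_geomConv_le {b : ℝ} (hb : 0 ≤ b) (hb1 : b < 1) {a w : ℕ → ℝ}
    (ha : ∀ t, 0 ≤ a t) (hw : ∀ t, 0 ≤ w t) (hanti : Antitone w) (T : ℕ) :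
    ∑ t ∈ Finset.range T, w t * geomConv b a (t + 1) ≤
      (∑ t ∈ Finset.range T, w t * a t) / (1 - b) := by
  -- The boundary term carries the induction: monotone weights let it pass from `w T` to `w (T +
  -- 1)`.
  have key : ∀ T, (1 - b) * ∑ t ∈ Finset.range T, w t * geomConv b a (t + 1) +
      b * (w T * geomConv b a T) ≤ ∑ t ∈ Finset.range T, w t * a t := by
    intro T
    induction T with
    | zero => simp [geomConv]
    | succ T ih =>
      rw [Finset.sum_range_succ, Finset.sum_range_succ]
      have h1 : b * (w (T + 1) * geomConv b a (T + 1)) ≤ b * (w T * geomConv b a (T + 1)) :=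
        mul_le_mul_of_nonneg_left (mul_le_mul_of_nonneg_right (hanti T.le_succ)
          (geomConv_nonneg hb ha _)) hb
      have h2 : w T * geomConv b a (T + 1) = w T * a T + b * (w T * geomConv b a T) := by
        rw [geomConv]; ring
      linarith
  rw [le_div_iff₀ (by linarith)]
  have := mul_nonneg hb (mul_nonneg (hw T) (geomConv_nonneg hb ha T))
  linarith [key T]

/-- Young's inequality 2yh ≤ y² + h² in each term; the y² terms sum to at most y²/(1-b), the fixed
point of z = y² + bz. -/
theorem two_mul_mul_geomConv_le {b : ℝ} (hb : 0 ≤ b) (hb1 : b < 1) (h : ℕ → ℝ) (y : ℝ) (t : ℕ) :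
    2 * y * geomConv b h t ≤ y ^ 2 / (1 - b) + geomConv b (fun s => h s ^ 2) t := by
  have h1b : 0 < 1 - b := by linarith
  induction t with
  | zero => simpa [geomConv] using div_nonneg (sq_nonneg y) h1b.le
  | succ t ih =>
    simp only [geomConv]
    have h1 := mul_le_mul_of_nonneg_left ih hb
    have h2 : y ^ 2 / (1 - b) = y ^ 2 + b * (y ^ 2 / (1 - b)) := by field_simp; ring
    nlinarith [sq_nonneg (y - h t)]

/-- Young's inequality makes monotonicity of `h` unnecessary. The convolution at `t + 1` involves `h
0, …, h t`, so the squares of both `h 0` and `h T` enter. -/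
theorem sum_mul_geomConv_self_le {b : ℝ} (hb : 0 ≤ b) (hb1 : b < 1) (h : ℕ → ℝ) (T : ℕ) :
    ∑ t ∈ Finset.range T, h (t + 1) * geomConv b h (t + 1) ≤
      (∑ t ∈ Finset.range (T + 1), h t ^ 2) / (1 - b) := by
  have h1 : ∑ t ∈ Finset.range T, 2 * (h (t + 1) * geomConv b h (t + 1)) ≤
      (∑ t ∈ Finset.range T, h (t + 1) ^ 2) / (1 - b) +
      ∑ t ∈ Finset.range T, geomConv b (fun s => h s ^ 2) (t + 1) := by
    rw [Finset.sum_div, ← Finset.sum_add_distrib]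
    refine Finset.sum_le_sum fun t _ => ?_
    linarith [two_mul_mul_geomConv_le hb hb1 h (h (t + 1)) (t + 1)]
  have h2 := sum_mul_geomConv_le hb hb1 (a := fun s => h s ^ 2) (w := fun _ => 1)
    (fun t => sq_nonneg _) (fun _ => zero_le_one) antitone_const T
  simp only [one_mul] at h2
  have h3 : (∑ t ∈ Finset.range T, h (t + 1) ^ 2) / (1 - b) ≤
      (∑ t ∈ Finset.range (T + 1), h t ^ 2) / (1 - b) := by
    rw [Finset.sum_range_succ' (fun t => h t ^ 2)]
    have : 0 ≤ h 0 ^ 2 := sq_nonneg _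
    gcongr
    linarith
  have h4 : (∑ t ∈ Finset.range T, h t ^ 2) / (1 - b) ≤
      (∑ t ∈ Finset.range (T + 1), h t ^ 2) / (1 - b) := by
    rw [Finset.sum_range_succ (fun t => h t ^ 2)]
    have : 0 ≤ h T ^ 2 := sq_nonneg _
    gcongr
    linarith
  rw [← Finset.mul_sum] at h1
  linarith

/-- Summation of the recursion for the expected descent `p` along the step direction. Here `h` is
the step size, with `h 0 = 0`, and `a` is the expected squared norm of the gradient. -/
theorem sum_mul_le_of_momentum_recursion {b : ℝ} (hb1 : b < 1) {h p a c bs : ℕ → ℝ}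
    {r D G : ℝ} (hr : 0 ≤ r) (hD : 0 ≤ D) (hG : 0 ≤ G) (hh0 : h 0 = 0) (hp0 : p 0 = 0)
    (hh : ∀ t, 0 ≤ h t) (ha : ∀ t, 0 ≤ a t) (hc : ∀ t, 0 ≤ c t)
    (hbs : ∀ t, 0 ≤ bs t) (hbs' : ∀ t, bs t ≤ b)
    (hp : ∀ t, (1 - bs t) * (r * a t) - D * c t + bs t * (p t - G * h t) ≤ p (t + 1))
    {w : ℕ → ℝ} (hw : Antitone w) {c₀ c₁ : ℝ} (hc₀ : 0 < c₀) (hc₁ : 0 < c₁)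
    (hwh : ∀ t, c₀ * w t ≤ h (t + 1) ∧ h (t + 1) ≤ c₁ * w t) (T : ℕ) :
    (1 - b) * r * ∑ t ∈ Finset.range T, h (t + 1) * a t ≤
      ∑ t ∈ Finset.range T, h (t + 1) * p (t + 1) +
      D * (c₁ / c₀) / (1 - b) * ∑ t ∈ Finset.range T, h (t + 1) * c t +
      b * G / (1 - b) * ∑ t ∈ Finset.range T, h (t + 1) ^ 2 := by
  have h1b : 0 < 1 - b := by linarith
  have hb : 0 ≤ b := (hbs 0).trans (hbs' 0)
  have hw0 : ∀ t, 0 ≤ w t := fun t =>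
    nonneg_of_mul_nonneg_right ((hh _).trans (hwh t).2) hc₁
  have hc' := geomConv_nonneg hb hc
  have hh' := geomConv_nonneg hb hh
  have lower : ∀ t, (1 - b) * r * a t - (D * geomConv b c (t + 1) + b * G * geomConv b h (t + 1)) ≤
      p (t + 1) := by
    have step : ∀ t, -(D * geomConv b c t + b * G * geomConv b h t) ≤ p t →
        (1 - b) * r * a t - (D * geomConv b c (t + 1) + b * G * geomConv b h (t + 1)) ≤
        p (t + 1) := by
      intro t ht
      refine le_trans ?_ (hp t)
      simp only [geomConv]
      have e1 : (1 - b) * (r * a t) ≤ (1 - bs t) * (r * a t) :=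
        mul_le_mul_of_nonneg_right (by linarith [hbs' t]) (mul_nonneg hr (ha t))
      have q0 : 0 ≤ D * geomConv b c t + b * G * geomConv b h t + G * h t := by
        have := hc' t; have := hh' t; have := hh t; positivity
      have e2 : bs t * (D * geomConv b c t + b * G * geomConv b h t + G * h t) ≤
          b * (D * geomConv b c t + b * G * geomConv b h t + G * h t) :=
        mul_le_mul_of_nonneg_right (hbs' t) q0
      have e3 : bs t * (-(D * geomConv b c t + b * G * geomConv b h t) - G * h t) ≤
          bs t * (p t - G * h t) := mul_le_mul_of_nonneg_left (by linarith) (hbs t)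
      linarith
    -- The squared-gradient term is nonnegative and can be dropped from the past, so only errors
    -- propagate through the recursion.
    have base : ∀ t, -(D * geomConv b c t + b * G * geomConv b h t) ≤ p t := by
      intro t
      induction t with
      | zero => simp [geomConv, hp0]
      | succ t ih =>
        have := step t ih
        have : 0 ≤ (1 - b) * r * a t := mul_nonneg (mul_nonneg h1b.le hr) (ha t)
        linarith
    exact fun t => step t (base t)
  have s1 : ∑ t ∈ Finset.range T, h (t + 1) * geomConv b c (t + 1) ≤
      (c₁ / c₀) / (1 - b) * ∑ t ∈ Finset.range T, h (t + 1) * c t := by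
    calc ∑ t ∈ Finset.range T, h (t + 1) * geomConv b c (t + 1)
        ≤ ∑ t ∈ Finset.range T, c₁ * (w t * geomConv b c (t + 1)) := by
          refine Finset.sum_le_sum fun t _ => ?_
          rw [← mul_assoc]
          exact mul_le_mul_of_nonneg_right (hwh t).2 (hc' _)
      _ = c₁ * ∑ t ∈ Finset.range T, w t * geomConv b c (t + 1) := by rw [Finset.mul_sum]
      _ ≤ c₁ * ((∑ t ∈ Finset.range T, w t * c t) / (1 - b)) :=
          mul_le_mul_of_nonneg_left (sum_mul_geomConv_le hb hb1 hc hw0 hw T) hc₁.le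
      _ = (c₁ / c₀) / (1 - b) * ∑ t ∈ Finset.range T, c₀ * w t * c t := by
          simp_rw [mul_assoc, ← Finset.mul_sum]
          field_simp
      _ ≤ (c₁ / c₀) / (1 - b) * ∑ t ∈ Finset.range T, h (t + 1) * c t := by
          refine mul_le_mul_of_nonneg_left (Finset.sum_le_sum fun t _ => ?_) (by positivity)
          exact mul_le_mul_of_nonneg_right (hwh t).1 (hc t)
  have s2 := sum_mul_geomConv_self_le hb hb1 h T
  rw [Finset.sum_range_succ' (fun t => h t ^ 2), hh0] at s2
  have s3 : ∑ t ∈ Finset.range T, h (t + 1) * ((1 - b) * r * a t -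
      (D * geomConv b c (t + 1) + b * G * geomConv b h (t + 1))) ≤
      ∑ t ∈ Finset.range T, h (t + 1) * p (t + 1) :=
    Finset.sum_le_sum fun t _ => mul_le_mul_of_nonneg_left (lower t) (hh _)
  have s4 : ∑ t ∈ Finset.range T, h (t + 1) * ((1 - b) * r * a t -
      (D * geomConv b c (t + 1) + b * G * geomConv b h (t + 1))) =
      (1 - b) * r * ∑ t ∈ Finset.range T, h (t + 1) * a t -
      (D * ∑ t ∈ Finset.range T, h (t + 1) * geomConv b c (t + 1) +
      b * G * ∑ t ∈ Finset.range T, h (t + 1) * geomConv b h (t + 1)) := by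
    simp only [Finset.mul_sum, ← Finset.sum_add_distrib, ← Finset.sum_sub_distrib]
    exact Finset.sum_congr rfl fun t _ => by ring
  have s5 := mul_le_mul_of_nonneg_left s1 hD
  have s6 := mul_le_mul_of_nonneg_left s2 (mul_nonneg hb hG)
  have s7 : b * G * ((∑ t ∈ Finset.range T, h (t + 1) ^ 2 + 0 ^ 2) / (1 - b)) =
      b * G / (1 - b) * ∑ t ∈ Finset.range T, h (t + 1) ^ 2 := by ring
  have s8 : D * ((c₁ / c₀) / (1 - b) * ∑ t ∈ Finset.range T, h (t + 1) * c t) =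
      D * (c₁ / c₀) / (1 - b) * ∑ t ∈ Finset.range T, h (t + 1) * c t := by ring
  linarith

/-! ### Deterministic estimates for one step -/

section Precond

variable {d : ℕ}

/-- The vector with coordinates `u i / √(v i + ε)`. -/
noncomputable def precond (ε : ℝ) (v u : EuclideanSpace ℝ (Fin d)) : EuclideanSpace ℝ (Fin d) :=
  WithLp.toLp 2 fun i => u i / Real.sqrt (v i + ε)

@[simp]
theorem precond_apply (ε : ℝ) (v u : EuclideanSpace ℝ (Fin d)) (i : Fin d) :
    precond ε v u i = u i / Real.sqrt (v i + ε) := rfl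

@[simp]
theorem precond_zero (ε : ℝ) (v : EuclideanSpace ℝ (Fin d)) : precond ε v 0 = 0 := by
  ext i; simp

theorem precond_add (ε : ℝ) (v u w : EuclideanSpace ℝ (Fin d)) :
    precond ε v (u + w) = precond ε v u + precond ε v w := by
  ext i; simp [add_div]

theorem precond_smul (ε : ℝ) (v : EuclideanSpace ℝ (Fin d)) (c : ℝ)
    (u : EuclideanSpace ℝ (Fin d)) : precond ε v (c • u) = c • precond ε v u := by
  ext i; simp [mul_div_assoc]

theorem precond_sum {ι : Type*} (A : Finset ι) (ε : ℝ) (v : EuclideanSpace ℝ (Fin d))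
    (u : ι → EuclideanSpace ℝ (Fin d)) :
    precond ε v (∑ j ∈ A, u j) = ∑ j ∈ A, precond ε v (u j) := by
  classical
  induction A using Finset.induction_on with
  | empty => simp
  | insert j A hj ih => rw [Finset.sum_insert hj, Finset.sum_insert hj, precond_add, ih]

theorem norm_le_mul_norm_of_coord {C : ℝ} (hC : 0 ≤ C) {y u : EuclideanSpace ℝ (Fin d)}
    (h : ∀ i, |y i| ≤ C * |u i|) : ‖y‖ ≤ C * ‖u‖ := by
  refine abs_le_of_sq_le_sq' ?_ (by positivity) |>.2
  rw [mul_pow, EuclideanSpace.real_norm_sq_eq, EuclideanSpace.real_norm_sq_eq, Finset.mul_sum]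
  refine Finset.sum_le_sum fun i _ => ?_
  rw [← sq_abs (y i), ← sq_abs (u i), ← mul_pow]
  exact pow_le_pow_left₀ (abs_nonneg _) (h i) 2

theorem abs_coord_le_norm (u : EuclideanSpace ℝ (Fin d)) (i : Fin d) : |u i| ≤ ‖u‖ :=
  PiLp.norm_apply_le u i

theorem norm_precond_le {ε : ℝ} (hε : 0 < ε) {v : EuclideanSpace ℝ (Fin d)} (hv : ∀ i, 0 ≤ v i)
    (u : EuclideanSpace ℝ (Fin d)) : ‖precond ε v u‖ ≤ ‖u‖ / Real.sqrt ε := by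
  have h0 : 0 < Real.sqrt ε := Real.sqrt_pos.2 hε
  rw [div_eq_inv_mul]
  refine norm_le_mul_norm_of_coord (by positivity) fun i => ?_
  rw [precond_apply, abs_div, abs_of_nonneg (Real.sqrt_nonneg _), ← div_eq_inv_mul]
  gcongr
  linarith [hv i]

/-- Rationalising, the difference is (b-a)/(√a √b (√a+√b)), and each square root is at least √ε. -/
theorem abs_inv_sqrt_sub_inv_sqrt_le {ε a b : ℝ} (hε : 0 < ε) (ha : ε ≤ a) (hb : ε ≤ b) :
    |(Real.sqrt a)⁻¹ - (Real.sqrt b)⁻¹| ≤ |a - b| / (ε * Real.sqrt ε) := by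
  have he : 0 < Real.sqrt ε := Real.sqrt_pos.2 hε
  have h1 : Real.sqrt ε ≤ Real.sqrt a := Real.sqrt_le_sqrt ha
  have h2 : Real.sqrt ε ≤ Real.sqrt b := Real.sqrt_le_sqrt hb
  have ha0 : 0 < Real.sqrt a := he.trans_le h1
  have hb0 : 0 < Real.sqrt b := he.trans_le h2
  have e1 : (Real.sqrt a)⁻¹ - (Real.sqrt b)⁻¹ =
      (b - a) / (Real.sqrt a * Real.sqrt b * (Real.sqrt a + Real.sqrt b)) := by
    field_simp
    nlinarith [Real.sq_sqrt (hε.le.trans ha), Real.sq_sqrt (hε.le.trans hb)]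
  rw [e1, abs_div, abs_sub_comm b a]
  rw [abs_of_pos (a := Real.sqrt a * Real.sqrt b * (Real.sqrt a + Real.sqrt b)) (by positivity)]
  refine div_le_div_of_nonneg_left (abs_nonneg _) (by positivity) ?_
  calc ε * Real.sqrt ε = Real.sqrt ε * Real.sqrt ε * Real.sqrt ε := by
        rw [Real.mul_self_sqrt hε.le]
    _ ≤ Real.sqrt a * Real.sqrt b * (Real.sqrt a + Real.sqrt b) := by
        gcongr
        linarith

theorem norm_precond_sub_precond_le {ε δ : ℝ} (hε : 0 < ε) {v v' : EuclideanSpace ℝ (Fin d)}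
    (hv : ∀ i, 0 ≤ v i) (hv' : ∀ i, 0 ≤ v' i) (hδ0 : 0 ≤ δ) (hδ : ∀ i, |v' i - v i| ≤ δ)
    (u : EuclideanSpace ℝ (Fin d)) :
    ‖precond ε v' u - precond ε v u‖ ≤ δ / (ε * Real.sqrt ε) * ‖u‖ := by
  refine norm_le_mul_norm_of_coord (by positivity) fun i => ?_
  have h := abs_inv_sqrt_sub_inv_sqrt_le hε (a := v' i + ε) (b := v i + ε)
    (by linarith [hv' i]) (by linarith [hv i])
  rw [PiLp.sub_apply, precond_apply, precond_apply, div_eq_mul_inv, div_eq_mul_inv, ← mul_sub,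
    abs_mul, mul_comm]
  refine mul_le_mul_of_nonneg_right (h.trans ?_) (abs_nonneg _)
  rw [add_sub_add_right_eq_sub]
  gcongr
  exact hδ i

theorem abs_inner_precond_sub_le {ε δ M : ℝ} (hε : 0 < ε) {v v' : EuclideanSpace ℝ (Fin d)}
    (hv : ∀ i, 0 ≤ v i) (hv' : ∀ i, 0 ≤ v' i) (hδ0 : 0 ≤ δ) (hδ : ∀ i, |v' i - v i| ≤ δ)
    {a u : EuclideanSpace ℝ (Fin d)} (ha : ‖a‖ ≤ M) (hu : ‖u‖ ≤ M) :
    |inner ℝ a (precond ε v' u) - inner ℝ a (precond ε v u)| ≤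
      Real.sqrt d * (M ^ 2 * δ / (ε * Real.sqrt ε)) := by
  have hM : 0 ≤ M := (norm_nonneg _).trans ha
  -- The estimate holds without √d; inserting that factor needs 1 ≤ √d, so dimension zero is
  -- separate.
  rcases Nat.eq_zero_or_pos d with rfl | hd
  · simp [Subsingleton.elim a 0]
  have hd1 : 1 ≤ Real.sqrt d := Real.one_le_sqrt.2 (by exact_mod_cast hd)
  rw [← inner_sub_right]
  calc |inner ℝ a (precond ε v' u - precond ε v u)|
      ≤ ‖a‖ * ‖precond ε v' u - precond ε v u‖ := abs_real_inner_le_norm _ _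
    _ ≤ M * (δ / (ε * Real.sqrt ε) * M) := by
        gcongr
        exact (norm_precond_sub_precond_le hε hv hv' hδ0 hδ u).trans (by gcongr)
    _ = 1 * (M ^ 2 * δ / (ε * Real.sqrt ε)) := by ring
    _ ≤ _ := by gcongr

theorem norm_sq_div_le_inner_precond {ε M : ℝ} (hε : 0 < ε) {v : EuclideanSpace ℝ (Fin d)}
    (hv : ∀ i, 0 ≤ v i) (hvM : ∀ i, v i ≤ M ^ 2) (a : EuclideanSpace ℝ (Fin d)) :
    ‖a‖ ^ 2 / Real.sqrt (M ^ 2 + ε) ≤ inner ℝ a (precond ε v a) := by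
  rw [EuclideanSpace.real_norm_sq_eq, PiLp.inner_apply, Finset.sum_div]
  refine Finset.sum_le_sum fun i _ => ?_
  have h1 : 0 < Real.sqrt (v i + ε) := Real.sqrt_pos.2 (by linarith [hv i])
  calc a i ^ 2 / Real.sqrt (M ^ 2 + ε) ≤ a i ^ 2 / Real.sqrt (v i + ε) := by
        gcongr
        exact hvM i
    _ = inner ℝ (a i) (precond ε v a i) := by
        simp only [precond_apply, RCLike.inner_apply, conj_trivial]; ring

/-- The bounds on the moments that are kept by the algorithm when the gradients are bounded. -/
structure AdamState.Bounded (M : ℝ) (s : AdamState d) : Prop where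
  m_le : ‖s.m‖ ≤ M
  v_nonneg : ∀ i, 0 ≤ s.v i
  v_le : ∀ i, s.v i ≤ M ^ 2

variable {ε η β θ M : ℝ} {g : EuclideanSpace ℝ (Fin d)} {s : AdamState d}

theorem sq_coord_le_sq {u : EuclideanSpace ℝ (Fin d)} (hu : ‖u‖ ≤ M) (i : Fin d) :
    u i ^ 2 ≤ M ^ 2 :=
  sq_le_sq.2 (((abs_coord_le_norm u i).trans hu).trans (le_abs_self M))

theorem adamStep_m (ε η β θ : ℝ) (g : EuclideanSpace ℝ (Fin d)) (s : AdamState d) :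
    (adamStep ε η β θ g s).m = β • s.m + (1 - β) • g := rfl

theorem adamStep_v_apply (ε η β θ : ℝ) (g : EuclideanSpace ℝ (Fin d)) (s : AdamState d)
    (i : Fin d) : (adamStep ε η β θ g s).v i = θ * s.v i + (1 - θ) * g i ^ 2 := rfl

theorem AdamState.Bounded.adamStep (hs : s.Bounded M) (hg : ‖g‖ ≤ M) (hβ0 : 0 ≤ β) (hβ1 : β ≤ 1)
    (hθ0 : 0 ≤ θ) (hθ1 : θ ≤ 1) : (adamStep ε η β θ g s).Bounded M where
  m_le := by
    rw [adamStep_m]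
    refine (norm_add_le _ _).trans ?_
    rw [norm_smul, norm_smul, Real.norm_of_nonneg hβ0, Real.norm_of_nonneg (by linarith)]
    nlinarith [mul_le_mul_of_nonneg_left hs.m_le hβ0,
      mul_le_mul_of_nonneg_left hg (sub_nonneg.2 hβ1)]
  v_nonneg i := by
    rw [adamStep_v_apply]
    exact add_nonneg (mul_nonneg hθ0 (hs.v_nonneg i))
      (mul_nonneg (sub_nonneg.2 hθ1) (sq_nonneg _))
  v_le i := by
    rw [adamStep_v_apply]
    nlinarith [mul_le_mul_of_nonneg_left (hs.v_le i) hθ0,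
      mul_le_mul_of_nonneg_left (sq_coord_le_sq hg i) (sub_nonneg.2 hθ1)]

theorem abs_adamStep_v_sub_le (hs : s.Bounded M) (hg : ‖g‖ ≤ M) (hθ1 : θ ≤ 1) (i : Fin d) :
    |(adamStep ε η β θ g s).v i - s.v i| ≤ (1 - θ) * M ^ 2 := by
  have h : (AGS.adamStep ε η β θ g s).v i - s.v i = (1 - θ) * (g i ^ 2 - s.v i) := by
    rw [adamStep_v_apply]; ring
  rw [h, abs_mul, abs_of_nonneg (sub_nonneg.2 hθ1)]
  refine mul_le_mul_of_nonneg_left (abs_le.2 ⟨?_, ?_⟩) (sub_nonneg.2 hθ1)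
  · linarith [hs.v_le i, sq_nonneg (g i)]
  · linarith [hs.v_nonneg i, sq_coord_le_sq hg i]

/-- Freezing the preconditioner at the old `v` makes the direction linear in the old momentum and
`g`; the second moment moves by at most (1-θ)M² per coordinate. -/
theorem inner_precond_adamStep_ge (hε : 0 < ε) (hs : s.Bounded M) (hg : ‖g‖ ≤ M) (hβ0 : 0 ≤ β)
    (hβ1 : β ≤ 1) (hθ0 : 0 ≤ θ) (hθ1 : θ ≤ 1) {a : EuclideanSpace ℝ (Fin d)} (ha : ‖a‖ ≤ M) :
    β * inner ℝ a (precond ε s.v s.m) + (1 - β) * inner ℝ a (precond ε s.v g) -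
      Real.sqrt d * M ^ 4 / (ε * Real.sqrt ε) * (1 - θ) ≤
    inner ℝ a (precond ε (adamStep ε η β θ g s).v (adamStep ε η β θ g s).m) := by
  have hs' := hs.adamStep (ε := ε) (η := η) hg hβ0 hβ1 hθ0 hθ1
  have h := abs_inner_precond_sub_le hε hs.v_nonneg hs'.v_nonneg
    (mul_nonneg (sub_nonneg.2 hθ1) (sq_nonneg M))
    (fun i => abs_adamStep_v_sub_le hs hg hθ1 i) ha hs'.m_le
  have e : inner ℝ a (precond ε s.v (AGS.adamStep ε η β θ g s).m) =
      β * inner ℝ a (precond ε s.v s.m) + (1 - β) * inner ℝ a (precond ε s.v g) := by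
    rw [adamStep_m, precond_add, precond_smul, precond_smul, inner_add_right,
      real_inner_smul_right, real_inner_smul_right]
  have e2 : Real.sqrt d * (M ^ 2 * ((1 - θ) * M ^ 2) / (ε * Real.sqrt ε)) =
      Real.sqrt d * M ^ 4 / (ε * Real.sqrt ε) * (1 - θ) := by ring
  rw [e, e2] at h
  linarith [(abs_le.1 h).1]

end Precond

/-! ### Expectations along the sequence of drawn indices -/

section History

variable {K : ℕ} {Ω : Type*} [MeasurableSpace Ω] {μ : Measure Ω} [IsProbabilityMeasure μ]
  {k : ℕ → Ω → Fin K}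

/-- A quantity determined by the first `t` draws is a function on a finite set, so measurability and
integrability need no regularity of the gradients. -/
theorem exists_eq_comp_history [Nonempty (Fin K)] {β : Type*} {t : ℕ} {Y : (ℕ → Fin K) → β}
    (hY : ∀ κ κ', (∀ s < t, κ (s + 1) = κ' (s + 1)) → Y κ = Y κ') :
    ∃ H : (Finset.range t → Fin K) → β,
      ∀ κ : ℕ → Fin K, Y κ = H fun i => κ (i + 1) := by
  classical
  refine ⟨fun c => Y fun n => if h : n - 1 ∈ Finset.range t then c ⟨n - 1, h⟩
    else Classical.arbitrary _, fun κ => hY _ _ fun s hs => ?_⟩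
  simp [hs]

theorem integrable_of_history [Nonempty (Fin K)] (hk : ∀ t, 1 ≤ t → Measurable (k t)) {t : ℕ}
    {Y : (ℕ → Fin K) → ℝ}
    (hY : ∀ κ κ', (∀ s < t, κ (s + 1) = κ' (s + 1)) → Y κ = Y κ') :
    Integrable (fun ω => Y fun s => k s ω) μ := by
  obtain ⟨H, hH⟩ := exists_eq_comp_history hY
  simp only [hH]
  have hm : Measurable fun ω => fun i : Finset.range t => k (i + 1) ω :=
    measurable_pi_lambda _ fun i => hk _ (by omega)
  exact (Integrable.of_finite (f := H)).comp_measurable hm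

/-- This stands in for conditional expectation: split according to the value of the next index and
factor each term by independence. -/
theorem integral_history_next [Nonempty (Fin K)] (hk : ∀ t, 1 ≤ t → Measurable (k t))
    (hunif : ∀ t, 1 ≤ t → ∀ j, μ.real {ω | k t ω = j} = 1 / (K : ℝ))
    (hindep : iIndepFun (fun t : ℕ => k (t + 1)) μ) {t : ℕ} {Y : (ℕ → Fin K) → Fin K → ℝ}
    (hY : ∀ κ κ', (∀ s < t, κ (s + 1) = κ' (s + 1)) → Y κ = Y κ') :
    ∫ ω, Y (fun s => k s ω) (k (t + 1) ω) ∂μ =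
      ∫ ω, 1 / (K : ℝ) * ∑ j, Y (fun s => k s ω) j ∂μ := by
  classical
  have hYi : ∀ j, Integrable (fun ω => Y (fun s => k s ω) j) μ := fun j =>
    integrable_of_history hk (Y := fun κ => Y κ j) fun κ κ' h => by rw [hY κ κ' h]
  obtain ⟨H, hH⟩ := exists_eq_comp_history hY
  have hind : IndepFun (fun ω (i : Finset.range t) => k (i + 1) ω)
      (fun ω (i : ({t} : Finset ℕ)) => k (i + 1) ω) μ :=
    hindep.indepFun_finset (Finset.range t) {t} (by simp) fun i => hk _ (by omega)
  have hmeas : ∀ j, MeasurableSet {ω | k (t + 1) ω = j} := fun j =>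
    hk (t + 1) (by omega) (measurableSet_singleton j)
  have hterm : ∀ j, ∫ ω, Y (fun s => k s ω) j * (if k (t + 1) ω = j then 1 else 0) ∂μ =
      (∫ ω, Y (fun s => k s ω) j ∂μ) * (1 / (K : ℝ)) := by
    intro j
    have hc := hind.comp (φ := fun c => H c j)
      (ψ := fun c : ({t} : Finset ℕ) → Fin K =>
        if c ⟨t, Finset.mem_singleton_self t⟩ = j then (1 : ℝ) else 0)
      (measurable_of_finite _) (measurable_of_finite _)
    have hY' : (fun ω => Y (fun s => k s ω) j) =
        (fun c => H c j) ∘ fun ω (i : Finset.range t) => k (i + 1) ω := by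
      funext ω; simp [hH]
    have hind_int : ∫ ω, (if k (t + 1) ω = j then (1 : ℝ) else 0) ∂μ = 1 / (K : ℝ) := by
      rw [← hunif (t + 1) (by omega) j, ← integral_indicator_one (hmeas j)]
      refine integral_congr_ae (Filter.Eventually.of_forall fun ω => ?_)
      simp [Set.indicator_apply]
    rw [← hind_int]
    have hi : AEStronglyMeasurable (fun ω => if k (t + 1) ω = j then (1 : ℝ) else 0) μ :=
      (Measurable.ite (hmeas j) measurable_const measurable_const).aestronglyMeasurable
    refine IndepFun.integral_fun_mul_eq_mul_integral ?_ (hYi j).aestronglyMeasurable hi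
    rw [hY']
    exact hc
  have hsplit : ∀ ω, Y (fun s => k s ω) (k (t + 1) ω) =
      ∑ j, Y (fun s => k s ω) j * (if k (t + 1) ω = j then 1 else 0) := by
    intro ω
    simp
  simp_rw [hsplit]
  rw [integral_finsetSum _ fun j _ => ?_, integral_const_mul,
    integral_finsetSum _ fun j _ => hYi j, Finset.mul_sum]
  · exact Finset.sum_congr rfl fun j _ => by rw [hterm j, mul_comm]
  · refine ((hYi j).indicator (hmeas j)).congr (Filter.Eventually.of_forall fun ω => ?_)
    simp [Set.indicator_apply]

end History

theorem adam_congr {d K : ℕ} (F : Fin K → EuclideanSpace ℝ (Fin d) → ℝ)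
    (S : ℕ → Matrix (Fin d) (Fin d) ℝ) (ε : ℝ) (η β θ : ℕ → ℝ) (x₀ : EuclideanSpace ℝ (Fin d))
    {κ κ' : ℕ → Fin K} {t : ℕ} (h : ∀ s < t, κ (s + 1) = κ' (s + 1)) :
    adam F S ε η β θ x₀ κ t = adam F S ε η β θ x₀ κ' t := by
  induction t with
  | zero => rfl
  | succ t ih =>
    rw [adam, adam, ih fun s hs => h s (by omega), h t (by omega)]

/-! ### The two inequalities for one step, and the convergence rate -/

section Step

variable {d : ℕ} {p q : EuclideanSpace ℝ (Fin d) → ℝ} {L : ℝ≥0} {M M' ε η : ℝ}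

/-- Used with p, q the smoothings by Σ_t, Σ_{t+1} and y, `s.x` the iterates x_{t-1}, x_t. The step
has length at most ηM/√ε, so the gradient drifts by O(η). -/
theorem inner_gradient_precond_ge (hp : LSmooth L p) (hε : 0 < ε) (hη : 0 ≤ η)
    {s : AdamState d} (hs : s.Bounded M) {y : EuclideanSpace ℝ (Fin d)}
    (hsx : s.x = y - η • precond ε s.v s.m)
    (hpq : ‖gradient q s.x - gradient p s.x‖ ≤ M' * η) :
    inner ℝ (gradient p y) (precond ε s.v s.m) -
      (M' + L * (M / Real.sqrt ε)) * (M / Real.sqrt ε) * η ≤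
    inner ℝ (gradient q s.x) (precond ε s.v s.m) := by
  have he : 0 < Real.sqrt ε := Real.sqrt_pos.2 hε
  have hM : 0 ≤ M := (norm_nonneg _).trans hs.m_le
  have hw : ‖precond ε s.v s.m‖ ≤ M / Real.sqrt ε :=
    (norm_precond_le hε hs.v_nonneg s.m).trans (by gcongr; exact hs.m_le)
  have hxy : ‖gradient p s.x - gradient p y‖ ≤ L * (η * (M / Real.sqrt ε)) := by
    rw [← dist_eq_norm]
    refine (hp.2.dist_le_mul _ _).trans ?_
    gcongr
    rw [dist_eq_norm, hsx, sub_sub_cancel_left, norm_neg, norm_smul, Real.norm_of_nonneg hη]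
    gcongr
  have hdiff : ‖gradient q s.x - gradient p y‖ ≤ (M' + L * (M / Real.sqrt ε)) * η := by
    have := norm_sub_le_norm_sub_add_norm_sub (gradient q s.x) (gradient p s.x) (gradient p y)
    linarith
  have h := (abs_le.1 (abs_real_inner_le_norm (gradient q s.x - gradient p y)
    (precond ε s.v s.m))).1
  have h2 : ‖gradient q s.x - gradient p y‖ * ‖precond ε s.v s.m‖ ≤
      (M' + L * (M / Real.sqrt ε)) * η * (M / Real.sqrt ε) :=
    mul_le_mul hdiff hw (norm_nonneg _) ((norm_nonneg _).trans hdiff)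
  rw [inner_sub_left] at h
  linarith

theorem LSmooth.le_of_step (hq : LSmooth L q) (hε : 0 < ε) (hη : 0 ≤ η)
    {s : AdamState d} (hs : s.Bounded M) {y : EuclideanSpace ℝ (Fin d)}
    (hsx : s.x = y - η • precond ε s.v s.m) :
    q s.x ≤ q y - η * inner ℝ (gradient q y) (precond ε s.v s.m) +
      L * (M / Real.sqrt ε) ^ 2 * η ^ 2 := by
  have he : 0 < Real.sqrt ε := Real.sqrt_pos.2 hε
  have hw : ‖precond ε s.v s.m‖ ≤ M / Real.sqrt ε :=
    (norm_precond_le hε hs.v_nonneg s.m).trans (by gcongr; exact hs.m_le)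
  have h := hq.le_add y s.x
  have e : s.x - y = -(η • precond ε s.v s.m) := by rw [hsx, sub_sub_cancel_left]
  rw [e, inner_neg_right, real_inner_smul_right, norm_neg, norm_smul, Real.norm_of_nonneg hη]
    at h
  have h2 : (L : ℝ) * (η * ‖precond ε s.v s.m‖) ^ 2 ≤ L * (η * (M / Real.sqrt ε)) ^ 2 := by
    gcongr
  rw [mul_pow η (M / Real.sqrt ε)] at h2
  linarith

end Step

/-! ### Averages, weighted minima and the final constants -/

theorem norm_average_le {E : Type*} [NormedAddCommGroup E] [NormedSpace ℝ E] {K : ℕ}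
    (hK : 0 < K) {v : Fin K → E} {C : ℝ} (hv : ∀ j, ‖v j‖ ≤ C) :
    ‖(1 / (K : ℝ)) • ∑ j, v j‖ ≤ C := by
  have hK' : (0 : ℝ) < K := by exact_mod_cast hK
  rw [norm_smul, Real.norm_of_nonneg (by positivity), one_div, inv_mul_le_iff₀ hK']
  refine (norm_sum_le _ _).trans ((Finset.sum_le_sum fun j _ => hv j).trans ?_)
  simp

theorem sum_Icc_one_eq_sum_range (a : ℕ → ℝ) (T : ℕ) :
    ∑ t ∈ Finset.Icc 1 T, a t = ∑ t ∈ Finset.range T, a (t + 1) := by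
  induction T with
  | zero => simp
  | succ T ih => rw [Finset.sum_Icc_succ_top (by omega), Finset.sum_range_succ, ih]

theorem inf'_mul_sum_le_sum_mul {ι : Type*} (A : Finset ι) (hA : A.Nonempty) (w a : ι → ℝ)
    (hw : ∀ i ∈ A, 0 ≤ w i) : A.inf' hA a * ∑ i ∈ A, w i ≤ ∑ i ∈ A, w i * a i := by
  rw [Finset.mul_sum]
  refine Finset.sum_le_sum fun i hi => ?_
  rw [mul_comm]
  exact mul_le_mul_of_nonneg_left (Finset.inf'_le a hi) (hw i hi)

/-- The descent and drift errors carry l M²/ε with weights 1-b and b over the common denominator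
(1-b)²; their total weight 1 is relaxed to 2. -/
theorem le_rate_of_weighted_bound {A X E₁ E₂ R b ε M M' l D κ : ℝ} (hR : 0 < R)
    (hb : b < 1) (hε : 0 < ε) (hl : 0 ≤ l) (hE₂ : 0 ≤ E₂)
    (h : (1 - b) * (1 / R) * A ≤ X + l * (M / Real.sqrt ε) ^ 2 * E₂ + D * κ / (1 - b) * E₁ +
      b * ((M' + l * (M / Real.sqrt ε)) * (M / Real.sqrt ε)) / (1 - b) * E₂) :
    A ≤ R / (1 - b) * X + R * (D * κ) / (1 - b) ^ 2 * E₁ +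
      R / (1 - b) ^ 2 * (2 * M ^ 2 * l / ε + b * M * M' / Real.sqrt ε) * E₂ := by
  have h1b : 0 < 1 - b := by linarith
  have he : 0 < Real.sqrt ε := Real.sqrt_pos.2 hε
  have hsq : (M / Real.sqrt ε) ^ 2 = M ^ 2 / ε := by rw [div_pow, Real.sq_sqrt hε.le]
  have e1 : b * ((M' + l * (M / Real.sqrt ε)) * (M / Real.sqrt ε)) =
      b * M * M' / Real.sqrt ε + b * (l * (M ^ 2 / ε)) := by rw [← hsq]; ring
  rw [hsq, e1] at h
  have h' := mul_le_mul_of_nonneg_left h (show 0 ≤ R / (1 - b) by positivity)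
  have e2 : R / (1 - b) * ((1 - b) * (1 / R) * A) = A := by field_simp
  rw [e2] at h'
  refine h'.trans ?_
  have hz : 0 ≤ l * (M ^ 2 / ε) := by positivity
  have key : R / (1 - b) ^ 2 * ((1 - b) * (l * (M ^ 2 / ε)) + b * (l * (M ^ 2 / ε))) * E₂ ≤
      R / (1 - b) ^ 2 * (2 * (l * (M ^ 2 / ε))) * E₂ := by
    gcongr
    linarith
  have e3 : R / (1 - b) * (X + l * (M ^ 2 / ε) * E₂ + D * κ / (1 - b) * E₁ +
      (b * M * M' / Real.sqrt ε + b * (l * (M ^ 2 / ε))) / (1 - b) * E₂) =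
      R / (1 - b) * X + R * (D * κ) / (1 - b) ^ 2 * E₁ +
      (R / (1 - b) ^ 2 * ((1 - b) * (l * (M ^ 2 / ε)) + b * (l * (M ^ 2 / ε))) * E₂ +
      R / (1 - b) ^ 2 * (b * M * M' / Real.sqrt ε) * E₂) := by
    field_simp
    ring
  rw [e3]
  have e4 : R / (1 - b) ^ 2 * (2 * M ^ 2 * l / ε + b * M * M' / Real.sqrt ε) * E₂ =
      R / (1 - b) ^ 2 * (2 * (l * (M ^ 2 / ε))) * E₂ +
      R / (1 - b) ^ 2 * (b * M * M' / Real.sqrt ε) * E₂ := by ring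
  rw [e4]
  linarith

end AGS

theorem mainTheorem5 {d K : ℕ} {Ω : Type*} [MeasurableSpace Ω]
    (μ : Measure Ω) [IsProbabilityMeasure μ]
    -- the objective `f` and the functions `F j` it is the mean of
    (f : EuclideanSpace ℝ (Fin d) → ℝ) (F : Fin K → EuclideanSpace ℝ (Fin d) → ℝ)
    (L : ℝ≥0) (hf : AGS.LSmooth L f)
    (fstar : ℝ) (hfstar : IsLeast (Set.range f) fstar)
    (hFdiff : ∀ j, Differentiable ℝ (F j))
    (hF : ∀ x, (1 / (K : ℝ)) * ∑ j, F j x = f x)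
    (hFgrad : ∀ x, (1 / (K : ℝ)) • ∑ j, gradient (F j) x = gradient f x)
    (lam : ℝ) (hlam : ∀ x, (1 / (K : ℝ)) * ∑ j, ‖gradient (F j) x‖ ^ 2 ≤ lam)
    -- the smoothing matrices, with the convention `S 0 = 0`
    (S : ℕ → Matrix (Fin d) (Fin d) ℝ) (hS0 : S 0 = 0) (hS : ∀ t, 1 ≤ t → (S t).PosDef)
    -- the parameters of the algorithm
    (ε : ℝ) (hε : 0 < ε) (η βs θ : ℕ → ℝ) (β : ℝ) (hβ : β < 1)
    (hη : ∀ t, 1 ≤ t → 0 < η t) (hβs : ∀ t, 1 ≤ t → 0 ≤ βs t ∧ βs t ≤ β)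
    (hθ : ∀ t, 1 ≤ t → 0 < θ t ∧ θ t < 1)
    (x₀ : EuclideanSpace ℝ (Fin d))
    -- the indices `k 1, k 2, …` are independent and uniform on the `K` indices
    (k : ℕ → Ω → Fin K) (hkmeas : ∀ t, 1 ≤ t → Measurable (k t))
    (hkunif : ∀ t, 1 ≤ t → ∀ j, μ.real {ω | k t ω = j} = 1 / (K : ℝ))
    (hkindep : iIndepFun (fun t : ℕ => k (t + 1)) μ)
    -- `η = Θ(α)` with `α` non-increasing
    (α : ℕ → ℝ) (hα : AntitoneOn α (Set.Ici 1))
    (C₀ C₀' : ℝ) (hC₀ : 0 < C₀) (hC₀' : 0 < C₀')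
    (hαη : ∀ t, 1 ≤ t → C₀ * α t ≤ η t ∧ η t ≤ C₀' * α t)
    -- the bound on the smoothed stochastic gradients
    (M : ℝ) (hM : ∀ t, 1 ≤ t → ∀ j x, ‖gradient (AGS.smooth (S t) (F j)) x‖ ≤ M)
    -- the bounds on the effect of a change of the smoothing matrix
    (B B' : Matrix (Fin d) (Fin d) ℝ → Matrix (Fin d) (Fin d) ℝ → ℝ)
    (hB : ∀ t, 1 ≤ t → ∀ x,
      |AGS.smooth (S t) f x - AGS.smooth (S (t - 1)) f x| ≤ B (S t) (S (t - 1)))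
    (hB' : ∀ t, 1 ≤ t → ∀ x,
      ‖gradient (AGS.smooth (S (t + 1)) f) x - gradient (AGS.smooth (S t) f) x‖
        ≤ B' (S (t + 1)) (S t))
    (M' : ℝ) (hM' : 0 < M') (hB'η : ∀ t, 1 ≤ t → B' (S (t + 1)) (S t) ≤ M' * η t)
    (hBsum : Summable fun t : ℕ => B (S (t + 1)) (S t))
    (T : ℕ) (hT : 1 ≤ T)
    -- the iterates, as random variables
    (x : ℕ → Ω → EuclideanSpace ℝ (Fin d))
    (hx : ∀ t ω, x t ω = (AGS.adam F S ε η βs θ x₀ (fun s => k s ω) t).x)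
    -- the constants
    (C₁ C₂ C₃ : ℝ)
    (hC₁ : C₁ = Real.sqrt (M ^ 2 + ε) / (1 - β) *
      (f x₀ - fstar + ∑ t ∈ Finset.Icc 1 T, B (S t) (S (t - 1))))
    (hC₂ : C₂ = Real.sqrt d * M ^ 4 * C₀' * Real.sqrt (M ^ 2 + ε) /
      (ε ^ (3 / 2 : ℝ) * C₀ * (1 - β) ^ 2))
    (hC₃ : C₃ = Real.sqrt (M ^ 2 + ε) / (1 - β) ^ 2 *
      (2 * M ^ 2 * L / ε + β * M * M' / Real.sqrt ε)) :
    -- the smoothed functions are differentiable and the expectations below exist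
    (∀ t ∈ Finset.Icc 1 T, Differentiable ℝ (AGS.smooth (S t) f) ∧
      (∀ j, Differentiable ℝ (AGS.smooth (S t) (F j))) ∧
      Integrable (fun ω => ‖gradient (AGS.smooth (S t) f) (x (t - 1) ω)‖ ^ 2) μ) ∧
    (Finset.Icc 1 T).inf' (Finset.nonempty_Icc.mpr hT)
        (fun t => ∫ ω, ‖gradient (AGS.smooth (S t) f) (x (t - 1) ω)‖ ^ 2 ∂μ) ≤
      (C₁ + C₂ * ∑ t ∈ Finset.Icc 1 T, η t * (1 - θ t) + C₃ * ∑ t ∈ Finset.Icc 1 T, η t ^ 2) /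
        ∑ t ∈ Finset.Icc 1 T, η t := by
  have hΩ : Nonempty Ω := μ.nonempty_of_neZero
  have hKn : Nonempty (Fin K) := hΩ.map (k 1)
  have hK : 0 < K := Fin.pos_iff_nonempty.2 hKn
  have hK' : (0 : ℝ) < K := by exact_mod_cast hK
  have hβ0 : 0 ≤ β := (hβs 1 le_rfl).1.trans (hβs 1 le_rfl).2
  have j₀ : Fin K := Classical.arbitrary _
  have hM0 : 0 ≤ M := (norm_nonneg _).trans (hM 1 le_rfl j₀ 0)
  -- the objective and its components are Lipschitz
  obtain ⟨G₀, hG₀⟩ : ∃ G₀ : ℝ≥0, ∀ j x, ‖gradient (F j) x‖ ≤ G₀ := by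
    -- Each single squared gradient norm is at most the whole sum, hence at most Kλ.
    refine ⟨(Real.sqrt (K * lam)).toNNReal, fun j x => ?_⟩
    rw [Real.coe_toNNReal _ (Real.sqrt_nonneg _)]
    refine Real.le_sqrt_of_sq_le ?_
    have h1 := hlam x
    rw [one_div, inv_mul_le_iff₀ hK'] at h1
    exact (Finset.single_le_sum (f := fun j => ‖gradient (F j) x‖ ^ 2)
      (fun i _ => sq_nonneg _) (Finset.mem_univ j)).trans h1
  have hFlip : ∀ j, LipschitzWith G₀ (F j) := fun j =>
    AGS.lipschitzWith_of_norm_gradient_le (hFdiff j) (hG₀ j)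
  have hflip : LipschitzWith G₀ f := AGS.lipschitzWith_of_norm_gradient_le hf.1 fun x => by
    rw [← hFgrad]
    exact AGS.norm_average_le hK fun j => hG₀ j x
  have hL : ∀ t, AGS.LSmooth L (AGS.smooth (S t) f) := fun t => hf.smooth hflip (S t)
  have hgrad : ∀ t x, gradient (AGS.smooth (S t) f) x =
      (1 / (K : ℝ)) • ∑ j, gradient (AGS.smooth (S t) (F j)) x := fun t x =>
    AGS.gradient_smooth_const_mul_sum hFlip hFdiff hF (S t) x
  have hgradM : ∀ t, 1 ≤ t → ∀ x, ‖gradient (AGS.smooth (S t) f) x‖ ≤ M := fun t ht x => by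
    rw [hgrad]
    exact AGS.norm_average_le hK fun j => hM t ht j x
  have hlower : ∀ t x, fstar ≤ AGS.smooth (S t) f x := fun t =>
    AGS.le_smooth hflip (fun x => hfstar.2 ⟨x, rfl⟩) (S t)
  -- the states and the descent along the steps, as functions of the drawn indices
  set st : ℕ → (ℕ → Fin K) → AGS.AdamState d := fun t κ => AGS.adam F S ε η βs θ x₀ κ t with hst
  have hst_succ : ∀ t κ, st (t + 1) κ = AGS.adamStep ε (η (t + 1)) (βs (t + 1)) (θ (t + 1))
      (gradient (AGS.smooth (S (t + 1)) (F (κ (t + 1)))) (st t κ).x) (st t κ) := fun t κ => rfl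
  have hst_congr : ∀ t κ κ', (∀ s < t, κ (s + 1) = κ' (s + 1)) → st t κ = st t κ' :=
    fun t κ κ' h => AGS.adam_congr F S ε η βs θ x₀ h
  have hbdd : ∀ t κ, (st t κ).Bounded M := by
    intro t κ
    induction t with
    | zero => exact ⟨by simpa [hst, AGS.adam] using hM0, by simp [hst, AGS.adam],
        fun _ => by simpa [hst, AGS.adam] using sq_nonneg M⟩
    | succ t ih =>
      rw [hst_succ]
      exact ih.adamStep (hM _ (by omega) _ _) (hβs _ (by omega)).1
        ((hβs _ (by omega)).2.trans hβ.le) (hθ _ (by omega)).1.le (hθ _ (by omega)).2.le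
  have hst_x : ∀ t κ, (st (t + 1) κ).x = (st t κ).x -
      η (t + 1) • AGS.precond ε (st (t + 1) κ).v (st (t + 1) κ).m := fun t κ => rfl
  -- At `t = 0` the truncated index `t - 1` is harmless, since the initial momentum vanishes.
  set P : ℕ → (ℕ → Fin K) → ℝ := fun t κ =>
    inner ℝ (gradient (AGS.smooth (S t) f) (st (t - 1) κ).x)
      (AGS.precond ε (st t κ).v (st t κ).m) with hP
  have hP0 : ∀ κ, P 0 κ = 0 := fun κ => by simp [hP, hst, AGS.adam]
  -- The value of `η 0` is unconstrained; setting it to zero removes the spurious drift before the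
  -- first step.
  set h : ℕ → ℝ := fun t => if t = 0 then 0 else η t with hh
  have hh_succ : ∀ t, h (t + 1) = η (t + 1) := fun t => by simp [hh]
  have hh_nonneg : ∀ t, 0 ≤ h t := fun t => by
    cases t with
    | zero => simp [hh]
    | succ t => rw [hh_succ]; exact (hη _ (by omega)).le
  set G : ℝ := (M' + L * (M / Real.sqrt ε)) * (M / Real.sqrt ε) with hG
  set D : ℝ := Real.sqrt d * M ^ 4 / (ε * Real.sqrt ε) with hD
  -- the recursion for the descent, before taking expectations
  have hmom : ∀ t κ, P t κ - G * h t ≤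
      inner ℝ (gradient (AGS.smooth (S (t + 1)) f) (st t κ).x)
        (AGS.precond ε (st t κ).v (st t κ).m) := by
    intro t κ
    cases t with
    | zero => simp [hP, hst, hh, AGS.adam]
    | succ t =>
      have := AGS.inner_gradient_precond_ge (hL (t + 1)) hε (hη (t + 1) (by omega)).le
        (hbdd (t + 1) κ) (hst_x t κ) (((hB' (t + 1) (by omega) (st (t + 1) κ).x)).trans
          (hB'η (t + 1) (by omega)))
      rw [hh_succ]
      exact this
  set Q : ℕ → (ℕ → Fin K) → Fin K → ℝ := fun t κ j =>
    inner ℝ (gradient (AGS.smooth (S (t + 1)) f) (st t κ).x)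
      (AGS.precond ε (st t κ).v (gradient (AGS.smooth (S (t + 1)) (F j)) (st t κ).x)) with hQ
  have hrec : ∀ t κ, (1 - βs (t + 1)) * Q t κ (κ (t + 1)) - D * (1 - θ (t + 1)) +
      βs (t + 1) * (P t κ - G * h t) ≤ P (t + 1) κ := by
    intro t κ
    obtain ⟨hb0, hb1⟩ := hβs (t + 1) (by omega)
    obtain ⟨ht0, ht1⟩ := hθ (t + 1) (by omega)
    have h1 := AGS.inner_precond_adamStep_ge (η := η (t + 1)) hε (hbdd t κ)
      (hM (t + 1) (by omega) (κ (t + 1)) (st t κ).x) hb0 (hb1.trans hβ.le) ht0.le ht1.le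
      (hgradM (t + 1) (by omega) (st t κ).x)
    have h2 := mul_le_mul_of_nonneg_left (hmom t κ) hb0
    rw [← hst_succ] at h1
    have h3 : P (t + 1) κ = inner ℝ (gradient (AGS.smooth (S (t + 1)) f) (st t κ).x)
      (AGS.precond ε (st (t + 1) κ).v (st (t + 1) κ).m) := rfl
    rw [h3]
    linarith
  -- The preconditioner is the same for every `j`, so by linearity the average over `j` replaces the
  -- stochastic gradient by the full one.
  have hQavg : ∀ t κ, ‖gradient (AGS.smooth (S (t + 1)) f) (st t κ).x‖ ^ 2 *
      (1 / Real.sqrt (M ^ 2 + ε)) ≤ 1 / (K : ℝ) * ∑ j, Q t κ j := by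
    intro t κ
    have h1 := AGS.norm_sq_div_le_inner_precond hε (hbdd t κ).v_nonneg (hbdd t κ).v_le
      (gradient (AGS.smooth (S (t + 1)) f) (st t κ).x)
    rw [mul_one_div]
    refine h1.trans (le_of_eq ?_)
    conv_lhs => rw [hgrad (t + 1) (st t κ).x, AGS.precond_smul, AGS.precond_sum,
      real_inner_smul_right, inner_sum, ← hgrad (t + 1) (st t κ).x]
  -- integrability
  have hPi : ∀ t, Integrable (fun ω => P t fun s => k s ω) μ := fun t =>
    AGS.integrable_of_history hkmeas (t := t) fun κ κ' hκ => by
      simp only [hP]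
      rw [hst_congr t κ κ' hκ, hst_congr (t - 1) κ κ' fun s hs => hκ s (by omega)]
  have hNi : ∀ t, Integrable (fun ω =>
      ‖gradient (AGS.smooth (S (t + 1)) f) (st t fun s => k s ω).x‖ ^ 2) μ := fun t =>
    AGS.integrable_of_history hkmeas (t := t)
      (Y := fun κ => ‖gradient (AGS.smooth (S (t + 1)) f) (st t κ).x‖ ^ 2)
      fun κ κ' hκ => by rw [hst_congr t κ κ' hκ]
  have hQcongr : ∀ t κ κ', (∀ s < t, κ (s + 1) = κ' (s + 1)) → Q t κ = Q t κ' :=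
    fun t κ κ' hκ => by
      simp only [hQ]
      rw [hst_congr t κ κ' hκ]
  have hQi : ∀ t, Integrable (fun ω => Q t (fun s => k s ω) (k (t + 1) ω)) μ := fun t =>
    AGS.integrable_of_history hkmeas (t := t + 1) (Y := fun κ => Q t κ (κ (t + 1)))
      fun κ κ' hκ => by
        rw [hQcongr t κ κ' fun s hs => hκ s (by omega), hκ t (by omega)]
  have hQsi : ∀ t, Integrable (fun ω => 1 / (K : ℝ) * ∑ j, Q t (fun s => k s ω) j) μ := fun t =>
    AGS.integrable_of_history hkmeas (t := t) (Y := fun κ => 1 / (K : ℝ) * ∑ j, Q t κ j)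
      fun κ κ' hκ => by rw [hQcongr t κ κ' hκ]
  -- the recursion in expectation
  set p : ℕ → ℝ := fun t => ∫ ω, P t (fun s => k s ω) ∂μ with hp
  set a : ℕ → ℝ := fun t =>
    ∫ ω, ‖gradient (AGS.smooth (S (t + 1)) f) (st t fun s => k s ω).x‖ ^ 2 ∂μ with ha
  set R : ℝ := Real.sqrt (M ^ 2 + ε) with hR
  have hRpos : 0 < R := Real.sqrt_pos.2 (by positivity)
  have hprec : ∀ t, (1 - βs (t + 1)) * (1 / R * a t) - D * (1 - θ (t + 1)) +
      βs (t + 1) * (p t - G * h t) ≤ p (t + 1) := by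
    intro t
    have i1 : Integrable (fun ω =>
        (1 - βs (t + 1)) * Q t (fun s => k s ω) (k (t + 1) ω)) μ := (hQi t).const_mul _
    have i2 : Integrable (fun ω => (1 - βs (t + 1)) * Q t (fun s => k s ω) (k (t + 1) ω) -
        D * (1 - θ (t + 1))) μ := i1.sub (integrable_const _)
    have i3 : Integrable (fun ω => βs (t + 1) * (P t (fun s => k s ω) - G * h t)) μ :=
      ((hPi t).sub (integrable_const _)).const_mul _
    have h1 := integral_mono (i2.add i3) (hPi (t + 1)) fun ω => hrec t fun s => k s ω
    rw [integral_add' i2 i3, integral_sub i1 (integrable_const _),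
      integral_const_mul (1 - βs (t + 1)), integral_const_mul (βs (t + 1)),
      integral_sub (hPi t) (integrable_const _), integral_const, integral_const,
      AGS.integral_history_next hkmeas hkunif hkindep (hQcongr t)] at h1
    simp only [probReal_univ, one_smul] at h1
    have h2 : a t * (1 / R) ≤ ∫ ω, 1 / (K : ℝ) * ∑ j, Q t (fun s => k s ω) j ∂μ := by
      rw [← integral_mul_const]
      exact integral_mono ((hNi t).mul_const _) (hQsi t) fun ω => hQavg t fun s => k s ω
    have h3 := mul_le_mul_of_nonneg_left h2
      (show 0 ≤ 1 - βs (t + 1) by linarith [(hβs (t + 1) (by omega)).2])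
    linarith
  -- the telescoping sum of the descent inequalities
  have htel : ∀ n κ, ∑ t ∈ Finset.range n, η (t + 1) * P (t + 1) κ ≤
      f x₀ - AGS.smooth (S n) f (st n κ).x +
      ∑ t ∈ Finset.range n, B (S (t + 1)) (S t) +
      L * (M / Real.sqrt ε) ^ 2 * ∑ t ∈ Finset.range n, η (t + 1) ^ 2 := by
    intro n κ
    induction n with
    -- The telescope starts at `f x₀` because smoothing with the zero matrix is the identity.
    | zero => simp [hS0, AGS.smooth_zero, hst, AGS.adam]
    | succ n ih =>
      rw [Finset.sum_range_succ, Finset.sum_range_succ, Finset.sum_range_succ, mul_add]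
      have h1 := (hL (n + 1)).le_of_step hε (hη (n + 1) (by omega)).le (hbdd (n + 1) κ)
        (hst_x n κ)
      have h2 := (abs_le.1 (hB (n + 1) (by omega) (st n κ).x)).2
      rw [Nat.add_sub_cancel] at h2
      have h3 : P (n + 1) κ = inner ℝ (gradient (AGS.smooth (S (n + 1)) f) (st n κ).x)
        (AGS.precond ε (st (n + 1) κ).v (st (n + 1) κ).m) := rfl
      rw [← h3] at h1
      linarith
  have hdesc : ∑ t ∈ Finset.range T, h (t + 1) * p (t + 1) ≤
      f x₀ - fstar + ∑ t ∈ Finset.range T, B (S (t + 1)) (S t) +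
      L * (M / Real.sqrt ε) ^ 2 * ∑ t ∈ Finset.range T, η (t + 1) ^ 2 := by
    simp only [hh_succ, hp, ← integral_const_mul]
    rw [← integral_finsetSum _ fun t _ => (hPi (t + 1)).const_mul _]
    refine (integral_mono (integrable_finsetSum _ fun t _ => (hPi (t + 1)).const_mul _)
      (integrable_const _) fun ω => (htel T fun s => k s ω).trans
        (add_le_add_left (add_le_add_left (sub_le_sub_left (hlower T _) _) _) _)).trans ?_
    simp
  -- the summed recursion
  have hmain := AGS.sum_mul_le_of_momentum_recursion hβ (h := h) (p := p) (a := a)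
    (c := fun t => 1 - θ (t + 1)) (bs := fun t => βs (t + 1)) (r := 1 / R) (D := D) (G := G)
    (by positivity) (by positivity) (by positivity) (by simp [hh]) (by simp [hp, hP0]) hh_nonneg
    (fun t => integral_nonneg fun ω => sq_nonneg _)
    (fun t => by linarith [(hθ (t + 1) (by omega)).2]) (fun t => (hβs (t + 1) (by omega)).1)
    (fun t => (hβs (t + 1) (by omega)).2) hprec (w := fun t => α (t + 1))
    (fun s t hst => hα (by simp) (by simp) (by omega)) hC₀ hC₀'
    (fun t => by rw [hh_succ]; exact hαη (t + 1) (by omega)) T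
  simp only [hh_succ] at hmain hdesc
  have hx' : ∀ t ω, x t ω = (st t fun s => k s ω).x := hx
  refine ⟨fun t ht => ⟨(hL t).1, fun j => AGS.differentiable_smooth (hFdiff j) (hFlip j) (S t), ?_⟩,
    ?_⟩
  · obtain ⟨n, rfl⟩ : ∃ n, t = n + 1 := ⟨t - 1, by have := (Finset.mem_Icc.1 ht).1; omega⟩
    simpa only [hx', Nat.add_sub_cancel] using hNi n
  have hE₂ : 0 ≤ ∑ t ∈ Finset.range T, η (t + 1) ^ 2 := Finset.sum_nonneg fun t _ => sq_nonneg _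
  have hrate := AGS.le_rate_of_weighted_bound (A := ∑ t ∈ Finset.range T, η (t + 1) * a t)
    (X := f x₀ - fstar + ∑ t ∈ Finset.range T, B (S (t + 1)) (S t))
    (E₁ := ∑ t ∈ Finset.range T, η (t + 1) * (1 - θ (t + 1))) (D := D) (κ := C₀' / C₀)
    (M := M) (M' := M') hRpos hβ hε L.coe_nonneg hE₂ (hmain.trans (by linarith))
  have hηsum : 0 < ∑ t ∈ Finset.Icc 1 T, η t :=
    Finset.sum_pos (fun t ht => hη t (Finset.mem_Icc.1 ht).1) (Finset.nonempty_Icc.mpr hT)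
  rw [le_div_iff₀ hηsum]
  refine (AGS.inf'_mul_sum_le_sum_mul _ _ η _
    fun t ht => (hη t (Finset.mem_Icc.1 ht).1).le).trans ?_
  have hε32 : ε ^ (3 / 2 : ℝ) = ε * Real.sqrt ε := by
    rw [Real.sqrt_eq_rpow, show (3 / 2 : ℝ) = 1 + 1 / 2 by norm_num, Real.rpow_add hε,
      Real.rpow_one]
  have hC₂' : C₂ = R * (D * (C₀' / C₀)) / (1 - β) ^ 2 := by
    rw [hC₂, hε32, hD]
    field_simp
  simp only [AGS.sum_Icc_one_eq_sum_range, Nat.add_sub_cancel, hx'] at hC₁ ⊢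
  rw [hC₁, hC₂', hC₃]
  exact hrate
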